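/- Let $\lambda_{\mathrm p}, m, r_{\mathrm d}, R>0$ and $r_{\mathsf K}\ge 0$, and let $\lambda_{\mathrm d}=\frac{m}{\pi r_{\mathrm d}^2}$. Consider a Matérn cluster process in $\mathbb R^2$: the parent points $x_1,x_2,\dots$ form a homogeneous Poisson point process of intensity $\lambda_{\mathrm p}$; the daughter processes $\Phi_{\mathrm d}^{(1)},\Phi_{\mathrm d}^{(2)},\dots$ are Poisson point processes with intensity $\lambda_{\mathrm d}\mathbb 1(\|y\|\le r_{\mathrm d})$, independent of each other and of the parents; and the cluster process is $\Phi=\bigcup_i (x_i+\Phi_{\mathrm d}^{(i)})$. Let $\Psi_{\mathrm M}=\bigcup_{z\in\Phi}(z+\mathcal B(o,R))$ be the associated Boolean model, where $\mathcal B(o,s)$ is the closed disc of radius $s$ about the origin $o$, and let $T=\mathbb P\big(\Psi_{\mathrm M}\cap\mathcal B(o,r_{\mathsf K})\neq\emptyset\big)$ be its capacity functional on $\mathcal B(o,r_{\mathsf K})$. Put $r=R+r_{\mathsf K}$ and $\beta=\min(r,r_{\mathrm d})$. Then $L\le T\le U$, where $$U=1-\exp\!\left(-\pi\lambda_{\mathrm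 p}(r_{\mathrm d}+r)^2\big(1-e^{-\lambda_{\mathrm d}\pi\beta^2}\big)\right),\qquad L=1-\exp\!\left(-\pi\lambda_{\mathrm p}(r_{\mathrm d}-r)^2\big(1-e^{-\lambda_{\mathrm d}\pi\beta^2}\big)\right).$$ Moreover, these simpler expressions are less tight than the expressions $L'$ and $U'$ defined below, in the sense that $L<L'$ and $U'<U$. Here, with $A=(r-r_{\mathrm d})^2(1-e^{-\lambda_{\mathrm d}\pi\beta^2})+4rr_{\mathrm d}$, $$U'=1-e^{-\pi\lambda_{\mathrm p}A}\exp\!\left(\frac{\pi\lambda_{\mathrm p}}{2\lambda_{\mathrm d}^2\beta^2}\Big[-1+2\lambda_{\mathrm d}\beta\big((r+r_{\mathrm d})-|r-r_{\mathrm d}|e^{-4\lambda_{\mathrm d}\beta^2}\big)+e^{-4\lambda_{\mathrm d}\beta^2}\Big]\right),$$ $$L'=1-e^{-\pi\lambda_{\mathrm p}A}\exp\!\left(\frac{2\lambda_{\mathrm p}}{\lambda_{\mathrm d}}\Big[-2+2e^{-\lambda_{\mathrm d}\pi\beta^2}-\pi\sqrt{\lambda_{\mathrm d}}\,(r+r_{\mathrm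 d})\,\mathrm{erf}\big(-\sqrt{\lambda_{\mathrm d}\pi}\,\beta\big)\Big]\right),$$ where $\mathrm{erf}(t)=\frac{2}{\sqrt\pi}\int_0^t e^{-s^2}\,ds$. -/

import Mathlib

open MeasureTheory ProbabilityTheory Set
open scoped Pointwise ENNReal

noncomputable section

namespace BooleanMatern

/-- The Euclidean plane. -/
abbrev Plane : Type := EuclideanSpace ℝ (Fin 2)

section PointProcess

variable {Ω : Type*}

/-- Number of points of the random set of points `Φ` in `B`. -/
def count (Φ : Ω → Set Plane) (B : Set Plane) (ω : Ω) : ℕ∞ := (Φ ω ∩ B).encard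

/-- The σ-algebra on `Ω` generated by a (simple) point process `Φ`, that is, by all its counting
variables on Borel sets. -/
abbrev sigmaPP (Φ : Ω → Set Plane) : MeasurableSpace Ω :=
  ⨆ B : {B : Set Plane // MeasurableSet B}, MeasurableSpace.comap (count Φ B.1) inferInstance

/-- `Φ` is a (simple) Poisson point process on the plane with intensity measure `Λ`: all counting
variables are measurable, the number of points in a Borel set `B` with `Λ B < ∞` is Poisson
distributed with mean `Λ B`, and the numbers of points in pairwise disjoint Borel sets are
independent. -/
structure IsPoissonPP [MeasurableSpace Ω] (P : Measure Ω) (Φ : Ω → Set Plane) (Λ : Measure Plane) : Prop where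
  measurable_count : ∀ B : Set Plane, MeasurableSet B → Measurable (count Φ B)
  law_count : ∀ B : Set Plane, MeasurableSet B → Λ B < ∞ →
    P.map (count Φ B) = (poissonMeasure (Λ B).toNNReal).map (fun n : ℕ => (n : ℕ∞))
  indep_count : ∀ (n : ℕ) (B : Fin n → Set Plane), (∀ i, MeasurableSet (B i)) →
    Pairwise (fun i j => Disjoint (B i) (B j)) → iIndepFun (fun i => count Φ (B i)) P

/-- Intensity of the daughter points inside the cluster disc: mean number `m` of points divided by
the area of the disc of radius `rd`. -/
def daughterIntensity (m rd : ℝ) : ℝ := m / (Real.pi * rd ^ 2)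

/-- The σ-algebras carrying the parent points (index `none`) and the `i`-th daughter process
(index `some i`). -/
abbrev clusterSigma (x : ℕ → Ω → Plane) (D : ℕ → Ω → Set Plane) : Option ℕ → MeasurableSpace Ω
  | none => ⨆ i, MeasurableSpace.comap (x i) inferInstance
  | some i => sigmaPP (D i)

/-- Parent points `x i` and daughter processes `D i` of a Matérn cluster process: the parents form
a homogeneous Poisson point process of intensity `lamP` (`x` lists its points, almost surely without
repetition), each `D i` is a Poisson point process of constant intensity `m / (π rd²)` in the disc of
radius `rd` about the origin, and the parents and all the daughter processes are independent. -/
structure IsMaternCluster [MeasurableSpace Ω] (P : Measure Ω) (x : ℕ → Ω → Plane) (D : ℕ → Ω → Set Plane)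
    (lamP m rd : ℝ) : Prop where
  measurable_parent : ∀ i, Measurable (x i)
  injective_parent : ∀ᵐ ω ∂P, Function.Injective (fun i => x i ω)
  parent : IsPoissonPP P (fun ω => range (fun i => x i ω))
    (ENNReal.ofReal lamP • (volume : Measure Plane))
  daughter : ∀ i, IsPoissonPP P (D i) (ENNReal.ofReal (daughterIntensity m rd) •
    (volume : Measure Plane).restrict (Metric.closedBall 0 rd))
  indep : iIndep (clusterSigma x D) P

/-- The cluster process: the union of the translated daughter processes `x i + D i`. -/
def clusterProcess (x : ℕ → Ω → Plane) (D : ℕ → Ω → Set Plane) (ω : Ω) : Set Plane :=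
  ⋃ i, x i ω +ᵥ D i ω

/-- The Boolean model over the point process `Φ` with grain the disc of radius `R`. -/
def booleanModel (Φ : Ω → Set Plane) (R : ℝ) (ω : Ω) : Set Plane :=
  ⋃ z ∈ Φ ω, z +ᵥ Metric.closedBall (0 : Plane) R

/-- The capacity functional of a random set `Ψ`: the probability that `Ψ` hits `K`. -/
def capacityFunctional [MeasurableSpace Ω] (P : Measure Ω) (Ψ : Ω → Set Plane)
    (K : Set Plane) : ℝ :=
  P.real {ω | (Ψ ω ∩ K).Nonempty}

end PointProcess

/-- The error function. -/
def erf (t : ℝ) : ℝ := 2 / Real.sqrt Real.pi * ∫ s in (0 : ℝ)..t, Real.exp (-s ^ 2)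

/-- `β(r) = min(r, rd)`. -/
def beta (rd r : ℝ) : ℝ := min r rd

/-- `A = (r - rd)² (1 - exp (-lamD π β²)) + 4 r rd`. -/
def auxA (lamD rd r : ℝ) : ℝ :=
  (r - rd) ^ 2 * (1 - Real.exp (-lamD * Real.pi * beta rd r ^ 2)) + 4 * r * rd

/-- The simple upper bound. -/
def simpleUpper (lamP lamD rd r : ℝ) : ℝ :=
  1 - Real.exp (-Real.pi * lamP * (rd + r) ^ 2 *
    (1 - Real.exp (-lamD * Real.pi * beta rd r ^ 2)))

/-- The simple lower bound. -/
def simpleLower (lamP lamD rd r : ℝ) : ℝ :=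
  1 - Real.exp (-Real.pi * lamP * (rd - r) ^ 2 *
    (1 - Real.exp (-lamD * Real.pi * beta rd r ^ 2)))

/-- The tighter upper bound, obtained by enclosing the intersection of two overlapping discs of
radii `r`, `rd` at distance `x` in a rectangle with sides `r + rd - x` and `2 β`. -/
def tightUpper (lamP lamD rd r : ℝ) : ℝ :=
  1 - Real.exp (-Real.pi * lamP * auxA lamD rd r) *
    Real.exp (Real.pi * lamP / (2 * lamD ^ 2 * beta rd r ^ 2) *
      (-1 + 2 * lamD * beta rd r *
          ((r + rd) - |r - rd| * Real.exp (-4 * lamD * beta rd r ^ 2))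
        + Real.exp (-4 * lamD * beta rd r ^ 2)))

/-- The tighter lower bound, obtained by inscribing in the intersection of two overlapping discs of
radii `r`, `rd` at distance `x` a disc of radius `(r + rd - x) / 2`. -/
def tightLower (lamP lamD rd r : ℝ) : ℝ :=
  1 - Real.exp (-Real.pi * lamP * auxA lamD rd r) *
    Real.exp (2 * lamP / lamD *
      (-2 + 2 * Real.exp (-lamD * Real.pi * beta rd r ^ 2)
        - Real.pi * Real.sqrt lamD * (r + rd) *
          erf (-Real.sqrt (lamD * Real.pi) * beta rd r)))

end BooleanMatern

end

/-! Put r = R + rK and β = min r rd. The Boolean model hits the test disc iff, for some parent x,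
its daughter process meets the disc of radius r about -x. Given the parents, these events are
independent, and a cluster misses with probability exp(-lamD · area), the area being that of the
overlap of this disc with the daughter disc. The overlap never exceeds πβ², equals πβ² when ‖x‖ ≤
|rd - r|, and is irrelevant when ‖x‖ > rd + r. With q = exp(-lamD π β²) and N the number of parents
in a disc S, the probability that all parents in S miss is therefore at least E q^N for any S, and
at most E q^N if S has radius |rd - r|. Since N is Poisson, E q^N = exp(-lamP |S| (1 - q)); the
radii rd + r and |rd - r| give U and L.

Conditioning on the parents is avoided: each is replaced by a countable label, a dense point within
ε, so that independence becomes a product formula over label vectors (`measure_markedEvent`). Radii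
change by multiples of ε, and ε → 0 concludes.

The strict comparisons with L' and U' involve no probability: they reduce to `gaussian_integral_lt`
and `mul_exp_neg_pi_mul_lt`. -/

namespace BooleanMatern

/-! ### Void probabilities and generating functions of Poisson processes. -/

/-- The probability generating function of the Poisson distribution. -/
theorem lintegral_pow_poissonMeasure (r : NNReal) {q : ℝ} (hq : 0 ≤ q) :
    ∫⁻ n, ENNReal.ofReal q ^ n ∂(poissonMeasure r) =
      ENNReal.ofReal (Real.exp (-(r * (1 - q)))) := by
  rw [lintegral_countable']
  have h1 : ∀ n : ℕ, ENNReal.ofReal q ^ n * poissonMeasure r {n} =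
      ENNReal.ofReal (Real.exp (-r) * ((q * r) ^ n / (n.factorial : ℝ))) := by
    intro n
    rw [poissonMeasure_singleton, ← ENNReal.ofReal_pow hq, ← ENNReal.ofReal_mul (by positivity)]
    congr 1
    rw [mul_pow]
    ring
  simp_rw [h1]
  have hs : HasSum (fun n : ℕ => Real.exp (-r) * ((q * r) ^ n / (n.factorial : ℝ)))
      (Real.exp (-r) * Real.exp (q * r)) := by
    refine HasSum.mul_left _ ?_
    rw [Real.exp_eq_exp_ℝ]
    exact NormedSpace.expSeries_div_hasSum_exp (q * (r : ℝ))
  rw [← ENNReal.ofReal_tsum_of_nonneg (fun n => by positivity) hs.summable, hs.tsum_eq,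
    ← Real.exp_add]
  congr 2
  ring

theorem setOf_disjoint_eq {Ω : Type*} (Φ : Ω → Set Plane) (B : Set Plane) :
    {ω | Disjoint (Φ ω) B} = count Φ B ⁻¹' {0} := by
  ext ω
  simp [count, disjoint_iff_inter_eq_empty]

theorem measurableSet_disjoint_sigmaPP {Ω : Type*} (Φ : Ω → Set Plane) {B : Set Plane}
    (hB : MeasurableSet B) :
    MeasurableSet[sigmaPP Φ] {ω | Disjoint (Φ ω) B} := by
  rw [setOf_disjoint_eq]
  have : MeasurableSpace.comap (count Φ B) inferInstance ≤ sigmaPP Φ :=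
    le_iSup (fun B : {B : Set Plane // MeasurableSet B} =>
      MeasurableSpace.comap (count Φ B.1) inferInstance) ⟨B, hB⟩
  exact this _ ⟨{0}, measurableSet_singleton _, rfl⟩

theorem IsPoissonPP.sigmaPP_le {Ω : Type*} {m0 : MeasurableSpace Ω} {P : Measure Ω}
    {Φ : Ω → Set Plane} {Λ : Measure Plane} (h : IsPoissonPP P Φ Λ) :
    sigmaPP Φ ≤ m0 :=
  iSup_le fun B => (h.measurable_count B.1 B.2).comap_le

section PoissonProcess

variable {Ω : Type*} [MeasurableSpace Ω] {P : Measure Ω} {Φ : Ω → Set Plane} {Λ : Measure Plane}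
  {B : Set Plane}

/-- The probability generating function of the number of points of a Poisson process in a set. -/
theorem IsPoissonPP.lintegral_pow_count (h : IsPoissonPP P Φ Λ) (hB : MeasurableSet B)
    (hΛ : Λ B < ∞) {q : ℝ} (hq : 0 ≤ q) :
    ∫⁻ ω, ENNReal.ofReal q ^ (count Φ B ω).toNat ∂P =
      ENNReal.ofReal (Real.exp (-((Λ B).toReal * (1 - q)))) := by
  -- `toNat` sends `⊤` to 0, which is harmless: the law of the count is carried by the finite
  -- values.
  have h1 : ∫⁻ ω, ENNReal.ofReal q ^ (count Φ B ω).toNat ∂P =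
      ∫⁻ n, ENNReal.ofReal q ^ (ENat.toNat n) ∂(P.map (count Φ B)) :=
    (lintegral_map (f := fun n : ℕ∞ => ENNReal.ofReal q ^ (ENat.toNat n))
      measurable_from_top (h.measurable_count B hB)).symm
  rw [h1, h.law_count B hB hΛ, lintegral_map measurable_from_top measurable_from_top]
  simpa [ENNReal.coe_toNNReal_eq_toReal] using lintegral_pow_poissonMeasure (Λ B).toNNReal hq

/-- The void probabilities of a Poisson process. -/
theorem IsPoissonPP.measure_disjoint (h : IsPoissonPP P Φ Λ) (hB : MeasurableSet B)
    (hΛ : Λ B < ∞) :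
    P {ω | Disjoint (Φ ω) B} = ENNReal.ofReal (Real.exp (-(Λ B).toReal)) := by
  rw [setOf_disjoint_eq, ← Measure.map_apply (h.measurable_count B hB) (measurableSet_singleton _),
    h.law_count B hB hΛ, Measure.map_apply measurable_from_top (measurableSet_singleton _)]
  have h2 : (fun n : ℕ => (n : ℕ∞)) ⁻¹' {0} = {0} := by
    ext n
    simp
  rw [h2, poissonMeasure_singleton]
  simp [ENNReal.coe_toNNReal_eq_toReal]

theorem IsPoissonPP.ae_disjoint (h : IsPoissonPP P Φ Λ) [IsProbabilityMeasure P]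
    (hB : MeasurableSet B) (hΛ : Λ B = 0) : ∀ᵐ ω ∂P, Disjoint (Φ ω) B := by
  have hm : MeasurableSet {ω | Disjoint (Φ ω) B} := by
    rw [setOf_disjoint_eq]
    exact h.measurable_count B hB (measurableSet_singleton _)
  rw [Filter.Eventually, mem_ae_iff_prob_eq_one hm, h.measure_disjoint hB (by simp [hΛ])]
  simp [hΛ]

theorem IsPoissonPP.ae_count_lt_top (h : IsPoissonPP P Φ Λ) (hB : MeasurableSet B)
    (hΛ : Λ B < ∞) : ∀ᵐ ω ∂P, count Φ B ω ≠ ⊤ := by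
  have h1 : P (count Φ B ⁻¹' {⊤}) = 0 := by
    rw [← Measure.map_apply (h.measurable_count B hB) (measurableSet_singleton _),
      h.law_count B hB hΛ, Measure.map_apply measurable_from_top (measurableSet_singleton _)]
    have h2 : (fun n : ℕ => (n : ℕ∞)) ⁻¹' {⊤} = ∅ := by
      ext n
      simp
    rw [h2, measure_empty]
  exact measure_eq_zero_iff_ae_notMem.1 h1

end PoissonProcess

/-! ### Finitely many parents with independent marks. -/

/-- The labels of the first `n` parents: the value of `c`, and whether the parent is in `S`. -/
def labels {Ω ι : Type*} (x : ℕ → Ω → Plane) (S : Set Plane) (c : Plane → ι) (n : ℕ) (ω : Ω) :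
    Fin n → ι × Prop :=
  fun i => (c (x i ω), x i ω ∈ S)

/-- The σ-algebra `m1` is left free: the ambient one serves for measurability, the one generated by
the parents for independence. -/
theorem measurable_labels {Ω : Type*} {m1 : MeasurableSpace Ω} {x : ℕ → Ω → Plane} {ι : Type*}
    [MeasurableSpace ι] {S : Set Plane} {c : Plane → ι} (hx : ∀ i, Measurable[m1] (x i))
    (hS : MeasurableSet S) (hc : Measurable c) (n : ℕ) : Measurable[m1] (labels x S c n) := by
  refine measurable_pi_lambda _ fun i => ?_
  exact (hc.comp (hx i)).prodMk (hS.mem.comp (hx i))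

/-- All parents in `S` among the first `n` satisfy the event attached to their label. -/
def markedEvent {Ω ι : Type*} (x : ℕ → Ω → Plane) (S : Set Plane) (c : Plane → ι)
    (H : ℕ → ι → Set Ω) (n : ℕ) : Set Ω :=
  {ω | ∀ i : Fin n, x i ω ∈ S → ω ∈ H i (c (x i ω))}

open Classical in
/-- The number of parents in `S` among the first `n`. -/
noncomputable def partialCount {Ω : Type*} (x : ℕ → Ω → Plane) (S : Set Plane) (n : ℕ) (ω : Ω) : ℕ :=
  ((Finset.range n).filter fun i => x i ω ∈ S).card

theorem measurableSet_imp_mem {Ω ι : Type*} {m1 : MeasurableSpace Ω} {H : ι → Set Ω}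
    (hH : ∀ k, MeasurableSet (H k)) (k : ι × Prop) :
    MeasurableSet {ω | k.2 → ω ∈ H k.1} := by
  obtain ⟨k, b⟩ := k
  by_cases hb : b
  · simpa [hb] using hH k
  · simp [hb]

section Marking

variable {Ω : Type*} [m0 : MeasurableSpace Ω] {P : Measure Ω}
  {x : ℕ → Ω → Plane} {D : ℕ → Ω → Set Plane} {lamP m rd : ℝ}
  {ι : Type*} [Countable ι] [MeasurableSpace ι] [MeasurableSingletonClass ι]
  {S : Set Plane} {c : Plane → ι} {H : ℕ → ι → Set Ω}

theorem measurableSet_markedEvent (hMC : IsMaternCluster P x D lamP m rd) (hS : MeasurableSet S)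
    (hc : Measurable c) (hH : ∀ i k, MeasurableSet[sigmaPP (D i)] (H i k)) (n : ℕ) :
    MeasurableSet (markedEvent x S c H n) := by
  have hK : Measurable (labels x S c n) := measurable_labels hMC.measurable_parent hS hc n
  have : markedEvent x S c H n = ⋃ κ : Fin n → ι × Prop,
      labels x S c n ⁻¹' {κ} ∩ ⋂ i : Fin n, {ω | (κ i).2 → ω ∈ H i (κ i).1} := by
    ext ω
    simp only [mem_iUnion, mem_inter_iff, mem_preimage, mem_singleton_iff, mem_iInter,
      exists_eq_left']
    rfl
  rw [this]
  exact MeasurableSet.iUnion fun κ => (hK (measurableSet_singleton κ)).inter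
    (MeasurableSet.iInter fun i =>
      (hMC.daughter i).sigmaPP_le _ (measurableSet_imp_mem (hH i) (κ i)))

/-- On each fibre of the label vector the marked event is an intersection of daughter events with
fixed labels, so independence of the parents and the daughter processes factorises it. -/
theorem measure_markedEvent (hMC : IsMaternCluster P x D lamP m rd) (hS : MeasurableSet S)
    (hc : Measurable c) (hH : ∀ i k, MeasurableSet[sigmaPP (D i)] (H i k)) (n : ℕ) :
    P (markedEvent x S c H n) = ∑' κ : Fin n → ι × Prop,
      P (labels x S c n ⁻¹' {κ}) * ∏ i : Fin n, P {ω | (κ i).2 → ω ∈ H i (κ i).1} := by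
  have hxnone : ∀ i, Measurable[clusterSigma x D none] (x i) := fun i =>
    Measurable.of_comap_le (le_iSup (fun i => MeasurableSpace.comap (x i) inferInstance) i)
  have hK : Measurable (labels x S c n) := measurable_labels hMC.measurable_parent hS hc n
  have hpiece : ∀ κ : Fin n → ι × Prop, P (labels x S c n ⁻¹' {κ} ∩ markedEvent x S c H n) =
      P (labels x S c n ⁻¹' {κ}) * ∏ i : Fin n, P {ω | (κ i).2 → ω ∈ H i (κ i).1} := by
    intro κ
    -- Only the parents and the first n daughter processes are kept, so that the index type is
    -- finite.
    have hind := hMC.indep.precomp (g := Option.map (Fin.val : Fin n → ℕ))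
      (Option.map_injective Fin.val_injective)
    let f : Option (Fin n) → Set Ω := fun o => match o with
      | none => labels x S c n ⁻¹' {κ}
      | some i => {ω | (κ i).2 → ω ∈ H i (κ i).1}
    have hf : ∀ o, MeasurableSet[(clusterSigma x D ∘ Option.map (Fin.val : Fin n → ℕ)) o] (f o) := by
      rintro (_ | i)
      · exact measurable_labels hxnone hS hc n (measurableSet_singleton κ)
      · exact measurableSet_imp_mem (hH i) (κ i)
    have := hind.meas_iInter hf
    rw [Fintype.prod_option] at this
    rw [← this]
    congr 1
    ext ω
    simp only [mem_inter_iff, mem_preimage, mem_singleton_iff, markedEvent, mem_ofPred_eq,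
      mem_iInter, Option.forall, f]
    constructor
    · rintro ⟨h1, h2⟩
      refine ⟨h1, fun i => ?_⟩
      rw [← h1]
      exact h2 i
    · rintro ⟨h1, h2⟩
      refine ⟨h1, fun i => ?_⟩
      have := h2 i
      rw [← h1] at this
      exact this
  simp_rw [← hpiece]
  rw [← measure_iUnion]
  · congr 1
    ext ω
    simp
  · intro κ κ' hne
    refine Disjoint.mono inter_subset_left inter_subset_left ?_
    exact Disjoint.preimage _ (by simpa using hne)
  · exact fun κ => (hK (measurableSet_singleton κ)).inter
      (measurableSet_markedEvent hMC hS hc hH n)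

-- The same expansion as in `measure_markedEvent`, with q for each event probability, so that the
-- two series compare termwise.
open Classical in
theorem lintegral_pow_partialCount (hx : ∀ i, Measurable (x i)) (hS : MeasurableSet S)
    (hc : Measurable c) (n : ℕ) (q : ℝ≥0∞) :
    ∫⁻ ω, q ^ partialCount x S n ω ∂P = ∑' κ : Fin n → ι × Prop,
      P (labels x S c n ⁻¹' {κ}) * ∏ i : Fin n, (if (κ i).2 then q else 1) := by
  have hK : Measurable (labels x S c n) := measurable_labels hx hS hc n
  have h1 : ∀ ω, q ^ partialCount x S n ω =
      (fun κ : Fin n → ι × Prop => ∏ i : Fin n, (if (κ i).2 then q else 1)) (labels x S c n ω) := by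
    intro ω
    have h2 := Fin.prod_univ_eq_prod_range (fun i => if x i ω ∈ S then q else 1) n
    refine Eq.trans ?_ h2.symm
    rw [Finset.prod_ite, Finset.prod_const, Finset.prod_const_one, mul_one, partialCount]
  simp_rw [h1]
  rw [← lintegral_map (f := fun κ : Fin n → ι × Prop => ∏ i : Fin n, (if (κ i).2 then q else 1))
    (measurable_of_countable _) hK, lintegral_countable']
  refine tsum_congr fun κ => ?_
  rw [Measure.map_apply hK (measurableSet_singleton κ), mul_comm]

theorem lintegral_pow_partialCount_le [IsProbabilityMeasure P]
    (hMC : IsMaternCluster P x D lamP m rd) (hS : MeasurableSet S) (hc : Measurable c)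
    (hH : ∀ i k, MeasurableSet[sigmaPP (D i)] (H i k)) {q : ℝ≥0∞}
    (hq : ∀ i, ∀ y ∈ S, q ≤ P (H i (c y))) (n : ℕ) :
    ∫⁻ ω, q ^ partialCount x S n ω ∂P ≤ P (markedEvent x S c H n) := by
  classical
  rw [measure_markedEvent hMC hS hc hH, lintegral_pow_partialCount hMC.measurable_parent hS hc]
  refine ENNReal.tsum_le_tsum fun κ => ?_
  -- `hq` covers only labels of points of S; a label vector that is never attained contributes zero,
  -- any other comes from actual parents.
  rcases (labels x S c n ⁻¹' {κ}).eq_empty_or_nonempty with h | ⟨ω, rfl⟩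
  · simp [h]
  · gcongr with i
    by_cases hi : x i ω ∈ S
    · simpa [labels, hi] using hq i _ hi
    · simp [labels, hi]

theorem measure_markedEvent_le [IsProbabilityMeasure P]
    (hMC : IsMaternCluster P x D lamP m rd) (hS : MeasurableSet S) (hc : Measurable c)
    (hH : ∀ i k, MeasurableSet[sigmaPP (D i)] (H i k)) {q : ℝ≥0∞}
    (hq : ∀ i, ∀ y ∈ S, P (H i (c y)) ≤ q) (n : ℕ) :
    P (markedEvent x S c H n) ≤ ∫⁻ ω, q ^ partialCount x S n ω ∂P := by
  classical
  rw [measure_markedEvent hMC hS hc hH, lintegral_pow_partialCount hMC.measurable_parent hS hc]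
  refine ENNReal.tsum_le_tsum fun κ => ?_
  rcases (labels x S c n ⁻¹' {κ}).eq_empty_or_nonempty with h | ⟨ω, rfl⟩
  · simp [h]
  · gcongr with i
    by_cases hi : x i ω ∈ S
    · simpa [labels, hi] using hq i _ hi
    · simp [labels, hi]

end Marking

/-! ### From the first n parents to all parents. -/

section TotalCount

variable {Ω : Type*} {x : ℕ → Ω → Plane} {S : Set Plane} {ω : Ω}

theorem count_range_eq (hinj : Function.Injective fun i => x i ω) :
    count (fun ω => range fun i => x i ω) S ω = {i | x i ω ∈ S}.encard := by
  have h1 : (range fun i => x i ω) ∩ S = (fun i => x i ω) '' {i | x i ω ∈ S} := by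
    ext y
    constructor
    · rintro ⟨⟨i, rfl⟩, hi⟩
      exact ⟨i, hi, rfl⟩
    · rintro ⟨i, hi, rfl⟩
      exact ⟨⟨i, rfl⟩, hi⟩
  rw [count, h1, hinj.injOn.encard_image]

theorem partialCount_le (hinj : Function.Injective fun i => x i ω)
    (hfin : count (fun ω => range fun i => x i ω) S ω ≠ ⊤) (n : ℕ) :
    partialCount x S n ω ≤ (count (fun ω => range fun i => x i ω) S ω).toNat := by
  classical
  rw [count_range_eq hinj] at hfin ⊢
  rw [partialCount, ← ENat.natCast_le_natCast, ENat.natCast_toNat hfin, ← Set.encard_coe_eq_coe_finsetCard]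
  exact encard_le_encard fun i hi => (Finset.mem_filter.1 hi).2

theorem eventually_partialCount_eq (hinj : Function.Injective fun i => x i ω)
    (hfin : count (fun ω => range fun i => x i ω) S ω ≠ ⊤) :
    ∀ᶠ n in Filter.atTop,
      partialCount x S n ω = (count (fun ω => range fun i => x i ω) S ω).toNat := by
  classical
  rw [count_range_eq hinj] at hfin ⊢
  have hI : {i | x i ω ∈ S}.Finite := encard_ne_top_iff.1 hfin
  obtain ⟨b, hb⟩ := hI.bddAbove
  filter_upwards [Filter.eventually_gt_atTop b] with n hn
  have h1 : ((Finset.range n).filter fun i => x i ω ∈ S : Set ℕ) = {i | x i ω ∈ S} := by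
    ext i
    simp only [Finset.coe_filter, Finset.mem_range, mem_ofPred_eq, and_iff_right_iff_imp]
    exact fun hi => (hb hi).trans_lt hn
  rw [← h1, Set.encard_coe_eq_coe_finsetCard, ENat.toNat_natCast, partialCount]

end TotalCount

section Marking

variable {Ω : Type*} [m0 : MeasurableSpace Ω] {P : Measure Ω} [IsProbabilityMeasure P]
  {x : ℕ → Ω → Plane} {D : ℕ → Ω → Set Plane} {lamP m rd : ℝ}
  {ι : Type*} [Countable ι] [MeasurableSpace ι] [MeasurableSingletonClass ι]
  {S : Set Plane} {c : Plane → ι} {H : ℕ → ι → Set Ω}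

theorem iInter_markedEvent {Ω ι : Type*} (x : ℕ → Ω → Plane) (S : Set Plane) (c : Plane → ι)
    (H : ℕ → ι → Set Ω) :
    ⋂ n, markedEvent x S c H n = {ω | ∀ i, x i ω ∈ S → ω ∈ H i (c (x i ω))} := by
  ext ω
  simp only [markedEvent, mem_iInter, mem_ofPred_eq]
  exact ⟨fun h i => h (i + 1) ⟨i, i.lt_succ_self⟩, fun h n i => h i⟩

theorem antitone_markedEvent {Ω ι : Type*} (x : ℕ → Ω → Plane) (S : Set Plane) (c : Plane → ι)
    (H : ℕ → ι → Set Ω) : Antitone (markedEvent x S c H) :=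
  fun _ _ hab _ h i => h ⟨i, i.2.trans_le hab⟩

theorem measurable_partialCount (hx : ∀ i, Measurable (x i)) (hS : MeasurableSet S) (n : ℕ) :
    Measurable (partialCount x S n) := by
  classical
  have h1 : partialCount x S n = fun ω => ∑ i ∈ Finset.range n, if x i ω ∈ S then 1 else 0 := by
    ext ω
    simp [partialCount]
  rw [h1]
  exact Finset.measurable_sum _ fun i _ =>
    Measurable.ite (hx i hS) measurable_const measurable_const

/-- If each parent in `S` independently satisfies the event attached to its label with
probability at least `q`, then all do with at least the probability obtained for constant `q`. -/
theorem exp_le_measure_forall_mem (hMC : IsMaternCluster P x D lamP m rd)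
    (hS : MeasurableSet S) (hSfin : volume S < ∞) (hlamP : 0 ≤ lamP) (hc : Measurable c)
    (hH : ∀ i k, MeasurableSet[sigmaPP (D i)] (H i k)) {q : ℝ} (hq0 : 0 ≤ q) (hq1 : q ≤ 1)
    (hq : ∀ i, ∀ y ∈ S, ENNReal.ofReal q ≤ P (H i (c y))) :
    ENNReal.ofReal (Real.exp (-(lamP * volume.real S * (1 - q)))) ≤
      P {ω | ∀ i, x i ω ∈ S → ω ∈ H i (c (x i ω))} := by
  have hΛ : (ENNReal.ofReal lamP • (volume : Measure Plane)) S < ∞ := by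
    simpa using ENNReal.mul_lt_top ENNReal.ofReal_lt_top hSfin
  have hpgf := hMC.parent.lintegral_pow_count hS hΛ hq0
  have hr : ((ENNReal.ofReal lamP • (volume : Measure Plane)) S).toReal =
      lamP * volume.real S := by
    simp [Measure.real, hlamP]
  rw [hr] at hpgf
  rw [← hpgf, ← iInter_markedEvent]
  refine ge_of_tendsto' (tendsto_measure_iInter_atTop
    (fun n => (measurableSet_markedEvent hMC hS hc hH n).nullMeasurableSet)
    (antitone_markedEvent x S c H) ⟨0, measure_ne_top _ _⟩) fun n => ?_
  refine le_trans (lintegral_mono_ae ?_) (lintegral_pow_partialCount_le hMC hS hc hH hq n)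
  filter_upwards [hMC.injective_parent, hMC.parent.ae_count_lt_top hS hΛ] with ω h1 h2
  -- As q ≤ 1, the full count gives a lower bound for every n; only the opposite inequality needs
  -- dominated convergence.
  exact pow_le_pow_of_le_one (by simp) (by simpa using hq1) (partialCount_le h1 h2 n)

/-- If each parent in `S` independently satisfies the event attached to its label with
probability at most `q`, then all do with at most the probability obtained for constant `q`. -/
theorem measure_forall_mem_le_exp (hMC : IsMaternCluster P x D lamP m rd)
    (hS : MeasurableSet S) (hSfin : volume S < ∞) (hlamP : 0 ≤ lamP) (hc : Measurable c)
    (hH : ∀ i k, MeasurableSet[sigmaPP (D i)] (H i k)) {q : ℝ} (hq0 : 0 ≤ q) (hq1 : q ≤ 1)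
    (hq : ∀ i, ∀ y ∈ S, P (H i (c y)) ≤ ENNReal.ofReal q) :
    P {ω | ∀ i, x i ω ∈ S → ω ∈ H i (c (x i ω))} ≤
      ENNReal.ofReal (Real.exp (-(lamP * volume.real S * (1 - q)))) := by
  have hΛ : (ENNReal.ofReal lamP • (volume : Measure Plane)) S < ∞ := by
    simpa using ENNReal.mul_lt_top ENNReal.ofReal_lt_top hSfin
  have hpgf := hMC.parent.lintegral_pow_count hS hΛ hq0
  have hr : ((ENNReal.ofReal lamP • (volume : Measure Plane)) S).toReal =
      lamP * volume.real S := by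
    simp [Measure.real, hlamP]
  rw [hr] at hpgf
  rw [← hpgf, ← iInter_markedEvent]
  refine ge_of_tendsto' (tendsto_lintegral_of_dominated_convergence
    (F := fun n ω => ENNReal.ofReal q ^ partialCount x S n ω) (fun _ => 1) (fun n => ?_)
    (fun n => ?_) ?_ ?_) fun n =>
      (measure_mono (iInter_subset _ n)).trans (measure_markedEvent_le hMC hS hc hH hq n)
  · exact (measurable_of_countable (fun k : ℕ => ENNReal.ofReal q ^ k)).comp
      (measurable_partialCount hMC.measurable_parent hS n)
  · exact Filter.Eventually.of_forall fun ω => pow_le_one' (by simpa using hq1) _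
  · simp
  · filter_upwards [hMC.injective_parent, hMC.parent.ae_count_lt_top hS hΛ] with ω h1 h2
    refine tendsto_const_nhds.congr' ?_
    filter_upwards [eventually_partialCount_eq h1 h2] with n hn
    rw [hn]

end Marking

/-! ### Geometry of hitting and discretisation of the plane. -/

theorem booleanModel_inter_closedBall_nonempty_iff {Ω : Type*} (x : ℕ → Ω → Plane)
    (D : ℕ → Ω → Set Plane) {R s : ℝ} (hR : 0 < R) (hs : 0 ≤ s) (ω : Ω) :
    (booleanModel (clusterProcess x D) R ω ∩ Metric.closedBall 0 s).Nonempty ↔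
      ∃ i, ∃ z ∈ D i ω, ‖x i ω + z‖ ≤ R + s := by
  constructor
  · rintro ⟨y, hy, hys⟩
    simp only [booleanModel, clusterProcess, mem_iUnion] at hy
    obtain ⟨_, ⟨i, z, hz, rfl⟩, w, hw, rfl⟩ := hy
    refine ⟨i, z, hz, ?_⟩
    simp only [vadd_eq_add, mem_closedBall_zero_iff] at hys hw
    calc ‖x i ω + z‖ = ‖(x i ω + z + w) - w‖ := by simp
      _ ≤ ‖x i ω + z + w‖ + ‖w‖ := norm_sub_le _ _
      _ ≤ R + s := by linarith
  · rintro ⟨i, z, hz, hle⟩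
    have hpos : 0 < R + s := by linarith
    -- The point dividing the segment from the origin to the cluster point in the ratio s : R.
    refine ⟨(s / (R + s)) • (x i ω + z), ?_, ?_⟩
    · simp only [booleanModel, clusterProcess, mem_iUnion]
      refine ⟨x i ω + z, ⟨i, z, hz, rfl⟩, -((R / (R + s)) • (x i ω + z)), ?_, ?_⟩
      · rw [mem_closedBall_zero_iff, norm_neg, norm_smul, Real.norm_of_nonneg (by positivity),
          div_mul_eq_mul_div, div_le_iff₀ hpos]
        gcongr
      · have h1 : s / (R + s) = 1 - R / (R + s) := by
          field_simp
          ring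
        simp only [vadd_eq_add]
        rw [h1, sub_smul, one_smul, sub_eq_add_neg]
    · rw [mem_closedBall_zero_iff, norm_smul, Real.norm_of_nonneg (by positivity),
        div_mul_eq_mul_div, div_le_iff₀ hpos]
      gcongr

/-- Points of the plane can be approximated measurably by points of a countable set. -/
theorem exists_measurable_nat_dist_lt {ε : ℝ} (hε : 0 < ε) :
    ∃ c : Plane → ℕ, Measurable c ∧
      ∀ y, dist (TopologicalSpace.denseSeq Plane (c y)) y < ε := by
  classical
  have hp : ∀ y : Plane, ∃ k, dist (TopologicalSpace.denseSeq Plane k) y < ε := fun y => by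
    obtain ⟨k, hk⟩ := (TopologicalSpace.denseRange_denseSeq Plane).exists_dist_lt y hε
    exact ⟨k, by rwa [dist_comm]⟩
  exact ⟨fun y => Nat.find (hp y), measurable_find hp fun k =>
    measurableSet_lt (by fun_prop) (by fun_prop), fun y => Nat.find_spec (hp y)⟩

theorem volume_real_closedBall (y : Plane) {s : ℝ} (hs : 0 ≤ s) :
    volume.real (Metric.closedBall y s) = Real.pi * s ^ 2 := by
  rw [Measure.real, EuclideanSpace.volume_closedBall_fin_two]
  simp [hs, Real.pi_pos.le, mul_comm]

/-! ### Bounds for the capacity functional. -/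

section Capacity

variable {Ω : Type*} [m0 : MeasurableSpace Ω] {P : Measure Ω}
  {x : ℕ → Ω → Plane} {D : ℕ → Ω → Set Plane} {lamP m rd R s : ℝ}

theorem daughterIntensity_nonneg (hm : 0 ≤ m) : 0 ≤ daughterIntensity m rd :=
  div_nonneg hm (by positivity)

theorem measure_disjoint_daughter (hMC : IsMaternCluster P x D lamP m rd) (hm : 0 ≤ m) (i : ℕ)
    {B : Set Plane} (hB : MeasurableSet B) :
    P {ω | Disjoint (D i ω) B} = ENNReal.ofReal (Real.exp
      (-(daughterIntensity m rd * volume.real (B ∩ Metric.closedBall 0 rd)))) := by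
  have hfin : volume (B ∩ Metric.closedBall (0 : Plane) rd) < ∞ :=
    (measure_mono inter_subset_right).trans_lt measure_closedBall_lt_top
  rw [(hMC.daughter i).measure_disjoint hB]
  · simp [Measure.restrict_apply hB, Measure.real, daughterIntensity_nonneg hm]
  · simpa [Measure.restrict_apply hB] using ENNReal.mul_lt_top ENNReal.ofReal_lt_top hfin

theorem ae_daughter_subset [IsProbabilityMeasure P]
    (hMC : IsMaternCluster P x D lamP m rd) :
    ∀ᵐ ω ∂P, ∀ i, D i ω ⊆ Metric.closedBall 0 rd := by
  rw [ae_all_iff]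
  intro i
  have hB : MeasurableSet (Metric.closedBall (0 : Plane) rd)ᶜ :=
    Metric.isClosed_closedBall.measurableSet.compl
  filter_upwards [(hMC.daughter i).ae_disjoint hB (by simp [Measure.restrict_apply hB])] with ω h
  exact disjoint_compl_right_iff_subset.1 h

/-- Enlarging the radius by ε makes the disc about the approximate centre contain the true one, so
missing the former implies missing the latter. -/
theorem capacityFunctional_le_of_pos [IsProbabilityMeasure P]
    (hMC : IsMaternCluster P x D lamP m rd) (hlamP : 0 ≤ lamP)
    (hm : 0 ≤ m) (hrd : 0 < rd) (hR : 0 < R) (hs : 0 ≤ s) {ε : ℝ} (hε : 0 < ε) :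
    capacityFunctional P (booleanModel (clusterProcess x D) R) (Metric.closedBall 0 s) ≤
      1 - Real.exp (-(lamP * (Real.pi * (rd + (R + s)) ^ 2) *
        (1 - Real.exp (-(daughterIntensity m rd * (Real.pi * min (R + s + ε) rd ^ 2)))))) := by
  obtain ⟨c, hc, hcd⟩ := exists_measurable_nat_dist_lt hε
  set d := TopologicalSpace.denseSeq Plane
  let H : ℕ → ℕ → Set Ω := fun i k =>
    {ω | Disjoint (D i ω) (Metric.closedBall (-d k) (R + s + ε))}
  have hBm : ∀ k, MeasurableSet (Metric.closedBall (-d k) (R + s + ε)) :=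
    fun k => Metric.isClosed_closedBall.measurableSet
  have hH : ∀ i k, MeasurableSet[sigmaPP (D i)] (H i k) :=
    fun i k => measurableSet_disjoint_sigmaPP _ (hBm k)
  have hlamD : 0 ≤ daughterIntensity m rd := daughterIntensity_nonneg hm
  have hS : MeasurableSet (Metric.closedBall (0 : Plane) (rd + (R + s))) :=
    Metric.isClosed_closedBall.measurableSet
  have hM : MeasurableSet {ω | ∀ i, x i ω ∈ Metric.closedBall (0 : Plane) (rd + (R + s)) →
      ω ∈ H i (c (x i ω))} := by
    rw [← iInter_markedEvent]
    exact MeasurableSet.iInter fun n => measurableSet_markedEvent hMC hS hc hH n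
  have hmain := exp_le_measure_forall_mem hMC hS measure_closedBall_lt_top hlamP hc hH
    (q := Real.exp (-(daughterIntensity m rd * (Real.pi * min (R + s + ε) rd ^ 2))))
    (Real.exp_pos _).le (Real.exp_le_one_iff.2 (neg_nonpos.2 (by positivity))) (by
      intro i y _
      rw [measure_disjoint_daughter hMC hm i (hBm _)]
      refine ENNReal.ofReal_le_ofReal (Real.exp_le_exp.2 (neg_le_neg ?_))
      refine mul_le_mul_of_nonneg_left ?_ hlamD
      rcases min_cases (R + s + ε) rd with ⟨h, _⟩ | ⟨h, _⟩ <;> rw [h]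
      · rw [← volume_real_closedBall (-d (c y)) (by positivity)]
        exact measureReal_mono inter_subset_left measure_closedBall_lt_top.ne
      · rw [← volume_real_closedBall 0 hrd.le]
        exact measureReal_mono inter_subset_right measure_closedBall_lt_top.ne)
  rw [volume_real_closedBall 0 (by positivity)] at hmain
  have hmain' := ENNReal.toReal_mono (measure_ne_top P _) hmain
  rw [ENNReal.toReal_ofReal (Real.exp_pos _).le, ← Measure.real] at hmain'
  refine le_trans ?_ (sub_le_sub_left hmain' 1)
  -- The hitting event need not be measurable: it is almost surely contained in the complement of a
  -- measurable event.
  rw [← probReal_compl_eq_one_sub hM]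
  refine ENNReal.toReal_mono (measure_ne_top P _) (measure_mono_ae ?_)
  filter_upwards [ae_daughter_subset hMC] with ω hsub hω hall
  obtain ⟨i, z, hz, hle⟩ := (booleanModel_inter_closedBall_nonempty_iff x D hR hs ω).1 hω
  have hzn : ‖z‖ ≤ rd := by simpa using hsub i hz
  have hxS : x i ω ∈ Metric.closedBall (0 : Plane) (rd + (R + s)) := by
    rw [mem_closedBall_zero_iff]
    calc ‖x i ω‖ = ‖(x i ω + z) - z‖ := by simp
      _ ≤ ‖x i ω + z‖ + ‖z‖ := norm_sub_le _ _
      _ ≤ rd + (R + s) := by linarith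
  refine disjoint_left.1 (hall i hxS) hz ?_
  have h1 := (hcd (x i ω)).le
  rw [dist_eq_norm] at h1
  rw [Metric.mem_closedBall, dist_eq_norm]
  calc ‖z - -d (c (x i ω))‖ = ‖(x i ω + z) + (d (c (x i ω)) - x i ω)‖ := by
        congr 1
        abel
    _ ≤ ‖x i ω + z‖ + ‖d (c (x i ω)) - x i ω‖ := norm_add_le _ _
    _ ≤ R + s + ε := by linarith

/-- The disc about the approximate centre is shrunk by ε to lie inside the true one. Shifting the
centre may cost another ε, so the overlap still contains a disc of radius β - 2ε. -/
theorem le_capacityFunctional_of_pos [IsProbabilityMeasure P]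
    (hMC : IsMaternCluster P x D lamP m rd) (hlamP : 0 ≤ lamP)
    (hm : 0 ≤ m) (hR : 0 < R) (hs : 0 ≤ s) {ε : ℝ} (hε : 0 < ε)
    (hε' : 2 * ε ≤ min (R + s) rd) :
    1 - Real.exp (-(lamP * (Real.pi * |rd - (R + s)| ^ 2) *
        (1 - Real.exp (-(daughterIntensity m rd *
          (Real.pi * (min (R + s) rd - 2 * ε) ^ 2)))))) ≤
      capacityFunctional P (booleanModel (clusterProcess x D) R) (Metric.closedBall 0 s) := by
  obtain ⟨c, hc, hcd⟩ := exists_measurable_nat_dist_lt hε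
  set d := TopologicalSpace.denseSeq Plane
  let H : ℕ → ℕ → Set Ω := fun i k =>
    {ω | Disjoint (D i ω) (Metric.closedBall (-d k) (R + s - ε))}
  have hBm : ∀ k, MeasurableSet (Metric.closedBall (-d k) (R + s - ε)) :=
    fun k => Metric.isClosed_closedBall.measurableSet
  have hH : ∀ i k, MeasurableSet[sigmaPP (D i)] (H i k) :=
    fun i k => measurableSet_disjoint_sigmaPP _ (hBm k)
  have hlamD : 0 ≤ daughterIntensity m rd := daughterIntensity_nonneg hm
  have hS : MeasurableSet (Metric.closedBall (0 : Plane) |rd - (R + s)|) :=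
    Metric.isClosed_closedBall.measurableSet
  have hmain := measure_forall_mem_le_exp hMC hS measure_closedBall_lt_top hlamP hc hH
    (q := Real.exp (-(daughterIntensity m rd * (Real.pi * (min (R + s) rd - 2 * ε) ^ 2))))
    (Real.exp_pos _).le (Real.exp_le_one_iff.2 (neg_nonpos.2 (by positivity))) (by
      intro i y hy
      rw [measure_disjoint_daughter hMC hm i (hBm _)]
      refine ENNReal.ofReal_le_ofReal (Real.exp_le_exp.2 (neg_le_neg ?_))
      refine mul_le_mul_of_nonneg_left ?_ hlamD
      rw [mem_closedBall_zero_iff] at hy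
      have h1 := (hcd y).le
      rw [dist_eq_norm] at h1
      have h2 : ‖d (c y)‖ ≤ |rd - (R + s)| + ε :=
        calc ‖d (c y)‖ = ‖(d (c y) - y) + y‖ := by simp
          _ ≤ ‖d (c y) - y‖ + ‖y‖ := norm_add_le _ _
          _ ≤ |rd - (R + s)| + ε := by linarith
      have hfin : volume (Metric.closedBall (-d (c y)) (R + s - ε) ∩
          Metric.closedBall (0 : Plane) rd) ≠ ∞ :=
        ((measure_mono inter_subset_right).trans_lt measure_closedBall_lt_top).ne
      rcases le_total (R + s) rd with h | h
      · rw [min_eq_left h] at hε' ⊢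
        rw [abs_of_nonneg (by linarith)] at h2
        rw [← volume_real_closedBall (-d (c y)) (by linarith)]
        refine measureReal_mono (subset_inter (Metric.closedBall_subset_closedBall (by linarith))
          (Metric.closedBall_subset_closedBall' ?_)) hfin
        rw [dist_zero_right, norm_neg]
        linarith
      · rw [min_eq_right h] at hε' ⊢
        rw [abs_of_nonpos (by linarith)] at h2
        rw [← volume_real_closedBall 0 (by linarith)]
        refine measureReal_mono (subset_inter (Metric.closedBall_subset_closedBall' ?_)
          (Metric.closedBall_subset_closedBall (by linarith))) hfin
        rw [dist_zero_left, norm_neg]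
        linarith)
  rw [volume_real_closedBall 0 (abs_nonneg _)] at hmain
  have hmain' := ENNReal.toReal_mono ENNReal.ofReal_ne_top hmain
  rw [ENNReal.toReal_ofReal (Real.exp_pos _).le, ← Measure.real] at hmain'
  refine le_trans (sub_le_sub_left hmain' 1) ?_
  -- Subadditivity replaces complementation, again sparing measurability of the hitting event.
  rw [sub_le_iff_le_add, ← probReal_univ (μ := P)]
  refine le_trans (measureReal_mono ?_) (measureReal_union_le _ _)
  intro ω _
  by_cases hω : (booleanModel (clusterProcess x D) R ω ∩ Metric.closedBall 0 s).Nonempty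
  · exact Or.inl hω
  · refine Or.inr fun i _ => disjoint_left.2 fun z hz hzb => hω ?_
    refine (booleanModel_inter_closedBall_nonempty_iff x D hR hs ω).2 ⟨i, z, hz, ?_⟩
    have h1 := (hcd (x i ω)).le
    rw [dist_eq_norm] at h1
    rw [Metric.mem_closedBall, dist_eq_norm] at hzb
    calc ‖x i ω + z‖ = ‖(z - -d (c (x i ω))) - (d (c (x i ω)) - x i ω)‖ := by
          congr 1
          abel
      _ ≤ ‖z - -d (c (x i ω))‖ + ‖d (c (x i ω)) - x i ω‖ := norm_sub_le _ _
      _ ≤ R + s := by linarith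

theorem capacityFunctional_le_simpleUpper [IsProbabilityMeasure P]
    (hMC : IsMaternCluster P x D lamP m rd)
    (hlamP : 0 ≤ lamP) (hm : 0 ≤ m) (hrd : 0 < rd) (hR : 0 < R) (hs : 0 ≤ s) :
    capacityFunctional P (booleanModel (clusterProcess x D) R) (Metric.closedBall 0 s) ≤
      simpleUpper lamP (daughterIntensity m rd) rd (R + s) := by
  let f : ℝ → ℝ := fun ε => 1 - Real.exp (-(lamP * (Real.pi * (rd + (R + s)) ^ 2) *
    (1 - Real.exp (-(daughterIntensity m rd * (Real.pi * min (R + s + ε) rd ^ 2))))))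
  have hf : Continuous f := by fun_prop
  have h0 : f 0 = simpleUpper lamP (daughterIntensity m rd) rd (R + s) := by
    simp only [f, simpleUpper, beta, add_zero]
    ring_nf
  rw [← h0]
  have ht : Filter.Tendsto f (nhdsWithin 0 (Ioi 0)) (nhds (f 0)) :=
    (hf.tendsto 0).mono_left nhdsWithin_le_nhds
  refine ge_of_tendsto ht ?_
  filter_upwards [self_mem_nhdsWithin] with ε hε
  exact capacityFunctional_le_of_pos hMC hlamP hm hrd hR hs hε

theorem simpleLower_le_capacityFunctional [IsProbabilityMeasure P]
    (hMC : IsMaternCluster P x D lamP m rd)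
    (hlamP : 0 ≤ lamP) (hm : 0 ≤ m) (hrd : 0 < rd) (hR : 0 < R) (hs : 0 ≤ s) :
    simpleLower lamP (daughterIntensity m rd) rd (R + s) ≤
      capacityFunctional P (booleanModel (clusterProcess x D) R) (Metric.closedBall 0 s) := by
  let f : ℝ → ℝ := fun ε => 1 - Real.exp (-(lamP * (Real.pi * |rd - (R + s)| ^ 2) *
    (1 - Real.exp (-(daughterIntensity m rd * (Real.pi * (min (R + s) rd - 2 * ε) ^ 2))))))
  have hf : Continuous f := by fun_prop
  have h0 : f 0 = simpleLower lamP (daughterIntensity m rd) rd (R + s) := by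
    simp only [f, simpleLower, beta, mul_zero, sub_zero, sq_abs]
    ring_nf
  rw [← h0]
  have ht : Filter.Tendsto f (nhdsWithin 0 (Ioi 0)) (nhds (f 0)) :=
    (hf.tendsto 0).mono_left nhdsWithin_le_nhds
  refine le_of_tendsto ht ?_
  have hβ : 0 < min (R + s) rd / 2 := half_pos (lt_min (by positivity) hrd)
  filter_upwards [self_mem_nhdsWithin, nhdsWithin_le_nhds (Iio_mem_nhds hβ)] with ε hε hε'
  exact le_capacityFunctional_of_pos hMC hlamP hm hR hs hε (by linarith [mem_Iio.1 hε'])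

end Capacity

/-! ### Analytic inequalities behind the strict comparisons. -/

theorem two_mul_sq_le_exp {h : ℝ} (hh : 0 ≤ h) :
    2 * h ^ 2 ≤ (2 * h - 1) * Real.exp h + Real.exp (-h) := by
  let f : ℝ → ℝ := fun h => (2 * h - 1) * Real.exp h + Real.exp (-h) - 2 * h ^ 2
  have hd : ∀ t, HasDerivAt f ((2 * t + 1) * Real.exp t - Real.exp (-t) - 4 * t) t := by
    intro t
    have h1 : HasDerivAt (fun t : ℝ => 2 * t - 1) 2 t := by
      simpa using ((hasDerivAt_id t).const_mul 2).sub_const 1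
    have h2 : HasDerivAt (fun t : ℝ => Real.exp (-t)) (-Real.exp (-t)) t := by
      simpa using (hasDerivAt_neg t).exp
    have h3 : HasDerivAt (fun t : ℝ => 2 * t ^ 2) (4 * t) t := by
      have := (hasDerivAt_pow 2 t).const_mul 2
      refine this.congr_deriv ?_
      norm_num
      ring
    refine (((h1.mul (Real.hasDerivAt_exp t)).add h2).sub h3).congr_deriv ?_
    ring
  have hmono : MonotoneOn f (Ici 0) := by
    refine monotoneOn_of_deriv_nonneg (convex_Ici 0)
      (fun t _ => (hd t).continuousAt.continuousWithinAt)
      (fun t _ => (hd t).differentiableAt.differentiableWithinAt) fun t ht => ?_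
    rw [interior_Ici, mem_Ioi] at ht
    rw [(hd t).deriv]
    have h1 : Real.exp (-t) ≤ (1 + t + t ^ 2 / 2)⁻¹ := by
      rw [Real.exp_neg]
      exact inv_anti₀ (by positivity) (Real.quadratic_le_exp_of_nonneg ht.le)
    -- This quadratic is chosen so that (2t + 1)(t + 1) - (1 - t + 2t²) = 4t, which makes the
    -- derivative nonnegative.
    have h2 : (1 + t + t ^ 2 / 2)⁻¹ ≤ 1 - t + 2 * t ^ 2 := by
      rw [inv_le_iff_one_le_mul₀ (by positivity)]
      have : 0 ≤ 3 / 2 * t ^ 2 + 3 / 2 * t ^ 3 + t ^ 4 := by positivity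
      nlinarith
    have h3 : t + 1 ≤ Real.exp t := Real.add_one_le_exp t
    nlinarith
  have := hmono (show (0 : ℝ) ∈ Ici 0 by simp) (show h ∈ Ici 0 from hh) hh
  simp only [f] at this
  norm_num at this
  linarith

/-- Strictness comes from π > 2. After multiplication by e^{2v} both sides are affine in w:
`two_mul_sq_le_exp` at 2v settles w = v, and 2v ≤ sinh 2v compares the slopes. -/
theorem mul_exp_neg_pi_mul_lt {v w : ℝ} (hv : 0 < v) (hvw : v ≤ w) :
    8 * v * w * Real.exp (-(Real.pi * v)) <
      -1 + 2 * (w + v) - 2 * (w - v) * Real.exp (-(4 * v)) + Real.exp (-(4 * v)) := by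
  have h1 := two_mul_sq_le_exp (h := 2 * v) (by positivity)
  have h2 : 2 * (2 * v) ≤ Real.exp (2 * v) - Real.exp (-(2 * v)) := by
    have := Real.self_le_sinh_iff.2 (show 0 ≤ 2 * v by positivity)
    rw [Real.sinh_eq] at this
    linarith
  have h3 : Real.exp (-(Real.pi * v)) < Real.exp (-(2 * v)) := by
    apply Real.exp_lt_exp.2
    nlinarith [Real.pi_gt_three]
  have h4 : Real.exp (-(4 * v)) = Real.exp (-(2 * v)) * Real.exp (-(2 * v)) := by
    rw [← Real.exp_add]
    ring_nf
  have h5 : Real.exp (2 * v) * Real.exp (-(2 * v)) = 1 := by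
    rw [← Real.exp_add]
    simp
  have hw : 0 < w := hv.trans_le hvw
  have h6 : 8 * v * w * Real.exp (-(Real.pi * v)) < 8 * v * w * Real.exp (-(2 * v)) := by
    gcongr
  have h7 : 8 * v * w ≤ (2 * (2 * v) - 1) * Real.exp (2 * v) + Real.exp (-(2 * v)) +
      2 * (w - v) * (Real.exp (2 * v) - Real.exp (-(2 * v))) := by
    nlinarith
  have h8 := mul_le_mul_of_nonneg_right h7 (Real.exp_pos (-(2 * v))).le
  rw [h4]
  calc _ < _ := h6
    _ ≤ _ := h8
    _ = (-1 + 2 * (w + v)) * (Real.exp (2 * v) * Real.exp (-(2 * v))) -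
      2 * (w - v) * (Real.exp (-(2 * v)) * Real.exp (-(2 * v))) +
      Real.exp (-(2 * v)) * Real.exp (-(2 * v)) := by ring
    _ = _ := by rw [h5, mul_one]

/-- Both sides are integrals over [0, t] of the nonnegative weight t + u - 2s, against e^{-s²} on
the left and 1 on the right. -/
theorem gaussian_integral_lt {t u : ℝ} (ht : 0 < t) (htu : t ≤ u) :
    (t + u) * (∫ s in (0 : ℝ)..t, Real.exp (-s ^ 2)) - (1 - Real.exp (-t ^ 2)) < t * u := by
  have h1 : ∫ s in (0 : ℝ)..t, 2 * s * Real.exp (-s ^ 2) = 1 - Real.exp (-t ^ 2) := by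
    have hd : ∀ s ∈ uIcc 0 t,
        HasDerivAt (fun s : ℝ => -Real.exp (-s ^ 2)) (2 * s * Real.exp (-s ^ 2)) s := by
      intro s _
      refine ((hasDerivAt_pow 2 s).fun_neg.exp.fun_neg).congr_deriv ?_
      norm_num
      ring
    rw [intervalIntegral.integral_eq_sub_of_hasDerivAt hd
      (Continuous.intervalIntegrable (by fun_prop) _ _)]
    norm_num
    ring
  have h2 : ∫ s in (0 : ℝ)..t, (t + u - 2 * s) = t * u := by
    rw [intervalIntegral.integral_sub (by simp)
      (Continuous.intervalIntegrable (by fun_prop) _ _), intervalIntegral.integral_const_mul]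
    simp
    ring
  rw [← h1, ← intervalIntegral.integral_const_mul, ← intervalIntegral.integral_sub
    (Continuous.intervalIntegrable (by fun_prop) _ _)
    (Continuous.intervalIntegrable (by fun_prop) _ _), ← h2]
  refine intervalIntegral.integral_lt_integral_of_continuousOn_of_le_of_exists_lt ht
    (by fun_prop) (by fun_prop) (fun s hs => ?_) ⟨t / 2, ⟨by linarith, by linarith⟩, ?_⟩
  · have h3 : Real.exp (-s ^ 2) ≤ 1 := Real.exp_le_one_iff.2 (by nlinarith)
    have h4 : 0 ≤ t + u - 2 * s := by linarith [hs.2]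
    nlinarith
  · have h3 : Real.exp (-(t / 2) ^ 2) < 1 := by
      rw [← Real.exp_zero, Real.exp_lt_exp]
      nlinarith
    have h4 : 0 < t + u - 2 * (t / 2) := by linarith
    nlinarith

theorem erf_neg (t : ℝ) : erf (-t) = -erf t := by
  have h1 : ∫ s in (0 : ℝ)..(-t), Real.exp (-s ^ 2) = -∫ s in (0 : ℝ)..t, Real.exp (-s ^ 2) := by
    have := intervalIntegral.integral_comp_neg (a := 0) (b := t)
      (fun s : ℝ => Real.exp (-s ^ 2))
    simp only [even_two, Even.neg_pow, neg_zero] at this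
    rw [this, intervalIntegral.integral_symm]
  rw [erf, erf, h1, mul_neg]

/-! ### Comparison of the simple and the tight expressions. -/

variable {lamP lamD rd r : ℝ}

/-- The terms with (r - rd)² cancel in the exponents. What remains is 4 lamP / lamD times
`gaussian_integral_lt` at t = gβ, u = gM, where g² = lamD π and M = max r rd. -/
theorem simpleLower_lt_tightLower (hlamP : 0 < lamP) (hlamD : 0 < lamD) (hrd : 0 < rd)
    (hr : 0 < r) : simpleLower lamP lamD rd r < tightLower lamP lamD rd r := by
  rw [simpleLower, tightLower, ← Real.exp_add]
  refine sub_lt_sub_left (Real.exp_lt_exp.2 ?_) 1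
  set b := beta rd r with hb
  have hb0 : 0 < b := lt_min hr hrd
  obtain ⟨M, hM, hsum, hprod⟩ : ∃ M, b ≤ M ∧ r + rd = b + M ∧ r * rd = b * M :=
    ⟨max r rd, min_le_max, (min_add_max r rd).symm, (min_mul_max r rd).symm⟩
  set g := Real.sqrt lamD * Real.sqrt Real.pi with hg
  have hg0 : 0 < g := by positivity
  have hgs : g ^ 2 = lamD * Real.pi := by
    rw [hg, mul_pow, Real.sq_sqrt hlamD.le, Real.sq_sqrt Real.pi_pos.le]
  have hgb : -Real.sqrt (lamD * Real.pi) * b = -(g * b) := by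
    rw [Real.sqrt_mul hlamD.le, hg]
    ring
  have key := gaussian_integral_lt (t := g * b) (u := g * M) (by positivity) (by gcongr)
  have he : -lamD * Real.pi * b ^ 2 = -(g * b) ^ 2 := by
    rw [mul_pow, hgs]
    ring
  rw [hgb, erf_neg, erf, auxA, ← hb, he, hsum]
  set I := ∫ s in (0 : ℝ)..(g * b), Real.exp (-s ^ 2)
  set e := Real.exp (-(g * b) ^ 2)
  have h1 : Real.pi * Real.sqrt lamD * (b + M) * -(2 / Real.sqrt Real.pi * I) =
      -(2 * g * (b + M) * I) := by
    have : Real.pi = Real.sqrt Real.pi * Real.sqrt Real.pi :=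
      (Real.mul_self_sqrt Real.pi_pos.le).symm
    rw [hg]
    nth_rw 1 [this]
    field_simp
  rw [h1]
  have h2 : 2 * lamP / lamD * (-2 + 2 * e - -(2 * g * (b + M) * I)) =
      4 * lamP / lamD * ((g * b + g * M) * I - (1 - e)) := by ring
  have h3 : 4 * lamP / lamD * (g * b * (g * M)) = Real.pi * lamP * (4 * (r * rd)) := by
    rw [hprod, show g * b * (g * M) = g ^ 2 * (b * M) by ring, hgs]
    field_simp
  have h4 := mul_lt_mul_of_pos_left key (show 0 < 4 * lamP / lamD by positivity)
  rw [h2]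
  rw [h3] at h4
  nlinarith [h4]

/-- Since (r + rd)² = (r - rd)² + 4 r rd, the exponents differ by a positive multiple of
`mul_exp_neg_pi_mul_lt` at v = lamD β², w = lamD βM, where M = max r rd. -/
theorem tightUpper_lt_simpleUpper (hlamP : 0 < lamP) (hlamD : 0 < lamD) (hrd : 0 < rd)
    (hr : 0 < r) : tightUpper lamP lamD rd r < simpleUpper lamP lamD rd r := by
  rw [simpleUpper, tightUpper, ← Real.exp_add]
  refine sub_lt_sub_left (Real.exp_lt_exp.2 ?_) 1
  set b := beta rd r with hb
  have hb0 : 0 < b := lt_min hr hrd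
  obtain ⟨M, hM, hsum, hprod, habs⟩ :
      ∃ M, b ≤ M ∧ r + rd = b + M ∧ r * rd = b * M ∧ |r - rd| = M - b :=
    ⟨max r rd, min_le_max, (min_add_max r rd).symm, (min_mul_max r rd).symm,
      (max_sub_min_eq_abs' r rd).symm⟩
  have key := mul_exp_neg_pi_mul_lt (v := lamD * b ^ 2) (w := lamD * b * M) (by positivity)
    (by rw [pow_two, ← mul_assoc]; gcongr)
  rw [auxA, ← hb, hsum, habs]
  rw [show -(Real.pi * (lamD * b ^ 2)) = -lamD * Real.pi * b ^ 2 by ring,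
    show -(4 * (lamD * b ^ 2)) = -4 * lamD * b ^ 2 by ring] at key
  set e := Real.exp (-lamD * Real.pi * b ^ 2)
  set E := Real.exp (-4 * lamD * b ^ 2)
  have h4 := mul_lt_mul_of_pos_left key
    (show 0 < Real.pi * lamP / (2 * lamD ^ 2 * b ^ 2) by positivity)
  have h5 : Real.pi * lamP / (2 * lamD ^ 2 * b ^ 2) *
      (8 * (lamD * b ^ 2) * (lamD * b * M) * e) = Real.pi * lamP * (4 * (r * rd)) * e := by
    rw [hprod]
    field_simp
    ring
  rw [h5] at h4
  have h6 : -1 + 2 * (lamD * b * M + lamD * b ^ 2) - 2 * (lamD * b * M - lamD * b ^ 2) * E + E =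
      -1 + 2 * lamD * b * ((b + M) - (M - b) * E) + E := by ring
  rw [h6] at h4
  refine lt_of_eq_of_lt ?_ (add_lt_add_right h4 _)
  ring

end BooleanMatern

theorem theorem4 {Ω : Type*} [MeasurableSpace Ω] (P : Measure Ω) [IsProbabilityMeasure P]
    (lamP m rd R rK : ℝ) (hlamP : 0 < lamP) (hm : 0 < m) (hrd : 0 < rd) (hR : 0 < R)
    (hrK : 0 ≤ rK) (x : ℕ → Ω → BooleanMatern.Plane) (D : ℕ → Ω → Set BooleanMatern.Plane)
    (hMC : BooleanMatern.IsMaternCluster P x D lamP m rd) :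
    BooleanMatern.simpleLower lamP (BooleanMatern.daughterIntensity m rd) rd (R + rK) ≤
        BooleanMatern.capacityFunctional P
          (BooleanMatern.booleanModel (BooleanMatern.clusterProcess x D) R)
          (Metric.closedBall 0 rK) ∧
      BooleanMatern.capacityFunctional P
          (BooleanMatern.booleanModel (BooleanMatern.clusterProcess x D) R)
          (Metric.closedBall 0 rK) ≤
        BooleanMatern.simpleUpper lamP (BooleanMatern.daughterIntensity m rd) rd (R + rK) ∧
      BooleanMatern.simpleLower lamP (BooleanMatern.daughterIntensity m rd) rd (R + rK) <
        BooleanMatern.tightLower lamP (BooleanMatern.daughterIntensity m rd) rd (R + rK) ∧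
      BooleanMatern.tightUpper lamP (BooleanMatern.daughterIntensity m rd) rd (R + rK) <
        BooleanMatern.simpleUpper lamP (BooleanMatern.daughterIntensity m rd) rd (R + rK) := by
  have hlamD : 0 < BooleanMatern.daughterIntensity m rd :=
    div_pos hm (mul_pos Real.pi_pos (pow_pos hrd 2))
  have hr : 0 < R + rK := add_pos_of_pos_of_nonneg hR hrK
  exact ⟨BooleanMatern.simpleLower_le_capacityFunctional hMC hlamP.le hm.le hrd hR hrK,
    BooleanMatern.capacityFunctional_le_simpleUpper hMC hlamP.le hm.le hrd hR hrK,
    BooleanMatern.simpleLower_lt_tightLower hlamP hlamD hrd hr,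
    BooleanMatern.tightUpper_lt_simpleUpper hlamP hlamD hrd hr⟩
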